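/- Let $m\ge 1$ and $n\ge 8$. Let $P$ be a probability distribution (the data generating process) of $(Y_1,Y_0,D,X)$, where $Y_1,Y_0$ are real potential outcomes, $D\in\{0,1\}$ is a treatment and $X$ takes values in $\mathscr X\subset\mathbb R^{m-1}$; let $Y=DY_1+(1-D)Y_0$, and let $S=(y_i,d_i,x_i)_{i=1}^n$ be an i.i.d. sample from the law of $(Y,D,X)$. Assume: 1. (External validity) $(Y_1,Y_0,X)$ has the same law in the target population as under $P$. 2. (Unconfoundedness) $(Y_1,Y_0)\perp\!\!\!\perp D\mid X$. 3. (Bounded outcomes) the support of $Y$ is contained in $[0,B]$, where $0<B<\infty$. 4. (Strict overlap) the propensity score $e(x)=\mathrm E_P(D\mid X=x)$ satisfies $e(x)\in[\psi,1-\psi]$ for all $x\in\mathscr X$, where $\psi\in(0,1/2)$. 5. (Margin) for a constant $c>0$ and all unit vectors $\beta^\dagger=(\gamma^\dagger,t^\dagger)$, $\beta^\ddagger=(\gamma^\ddagger,t^\ddagger)$ in $\mathbb R^{m-1}\times\mathbb R=\mathbb R^m$, $$P\big((X'\gamma^\dagger-t^\dagger)(X'\gamma^\ddagger-t^\ddagger)\le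 0\big)\le c\,\|\beta^\dagger-\beta^\ddagger\|_2 .$$ For a unit vector $\beta=(\gamma,t)\in\mathbb S^{m-1}$ let $f_\beta(x)=1\{x'\gamma\ge t\}$ be the Linear Eligibility Score rule with index $\beta$. With the weight $$H=\frac{Y\psi/B}{e(X)D+(1-e(X))(1-D)}$$ and its sample values $h_i$, define the welfare risk $R(\beta)=\mathrm E_P\big(H\,1\{f_\beta(X)\ne D\}\big)$ and the empirical welfare risk $R_S(\beta)=\frac1n\sum_{i=1}^n h_i\,1\{f_\beta(x_i)\neq d_i\}$. For a probability distribution $\Pi$ on $\mathbb S^{m-1}$ let $R^\Pi=\int R\,d\Pi$ and $R_S^\Pi=\int R_S\,d\Pi$, and let $\overline R=\inf_\Pi R^\Pi$, the infimum over all probability distributions on $\mathbb S^{m-1}$. Let $\pi_0$ be the uniform distribution on $\mathbb S^{m-1}$ and let $\mathscr V$ be the von Mises–Fisher family, i.e. all distributions with a density $$\beta\mapsto\frac{\kappa^{m/2-1}\exp(\kappa\,\mu'\beta)}{(2\pi)^{m/2}I_{m/2-1}(\kappa)},\qquad \kappa>0,\ \mu\in\mathbb S^{m-1},$$ with respect to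 the surface measure, where $I_\nu$ is the modified Bessel function of the first kind of order $\nu$. Let $\epsilon\in(0,1)$. For $\delta\ge 0$ call $\tilde\Pi\in\mathscr V$ a $\delta$-minimiser if it minimises $$R_S^\Pi+\sqrt{\frac1{2n}\Big(\mathrm{KL}(\Pi\,\|\,\pi_0)+\ln\frac{2\sqrt n}{\epsilon}\Big)}$$ over $\Pi\in\mathscr V$ up to an additive error of at most $\delta$; a variational posterior is an exact minimiser ($\delta=0$). Then, with probability at least $1-\epsilon$ over the sample, simultaneously for all $\delta\ge0$ and all $\delta$-minimisers $\tilde\Pi$, $$R^{\tilde\Pi}-\overline R\le M\,\frac{\ln n}{\sqrt n}+\delta ;$$ in particular every variational posterior satisfies $R^{\tilde\Pi}-\overline R\le M\ln(n)/\sqrt n$. Here, with $\nu=m/2-1$, $$M=4c\sqrt{\nu+1}+1+\Big(\nu+\tfrac12\Big)\frac{\ln 9}{\ln 8}+\ln\frac{2e}{\epsilon}+\sqrt{\frac{(\nu+\frac12)\ln 9}{2\ln 8}}+\sqrt{\tfrac12\ln\frac{4e}{\epsilon}}+\frac{\sqrt{\ln 8}}{\sqrt2\,\ln 8}.$$ 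-/

import Mathlib

open MeasureTheory ProbabilityTheory Set
open scoped ENNReal

namespace WelfareRegret

noncomputable section

/-! ### The population and the data -/

/-- The covariate space `ℝ^d`, where `d = m - 1`. -/
abbrev Cov (d : ℕ) : Type := EuclideanSpace ℝ (Fin d)

/-- A draw `(Y₁, Y₀, D, X)` from the data generating process (`D = true` means treated). -/
abbrev Draw (d : ℕ) : Type := ℝ × ℝ × Bool × Cov d

/-- An observation `(Y, D, X)`. -/
abbrev Obs (d : ℕ) : Type := ℝ × Bool × Cov d

variable {d : ℕ}

/-- The potential outcome `Y₁` under treatment. -/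
def Draw.y1 (w : Draw d) : ℝ := w.1

/-- The potential outcome `Y₀` without treatment. -/
def Draw.y0 (w : Draw d) : ℝ := w.2.1

/-- The treatment indicator `D`. -/
def Draw.treat (w : Draw d) : Bool := w.2.2.1

/-- The covariate vector `X`. -/
def Draw.cov (w : Draw d) : Cov d := w.2.2.2

/-- What is observed of a draw: `(Y, D, X)` with `Y = D Y₁ + (1 - D) Y₀`. -/
def observe (w : Draw d) : Obs d :=
  (if Draw.treat w then Draw.y1 w else Draw.y0 w, Draw.treat w, Draw.cov w)

/-- The law of a single observation `(Y, D, X)` when the data generating process is `P`. -/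
def obsLaw (P : Measure (Draw d)) : Measure (Obs d) := P.map observe

/-- The law of a sample of `n` i.i.d. observations. -/
def sampleLaw (P : Measure (Draw d)) (n : ℕ) : Measure (Fin n → Obs d) :=
  Measure.pi fun _ => obsLaw P

theorem measurable_cov : Measurable (Draw.cov : Draw d → Cov d) :=
  measurable_snd.comp (measurable_snd.comp measurable_snd)

/-- The sigma-algebra generated by the covariates. -/
abbrev sigmaX (d : ℕ) : MeasurableSpace (Draw d) :=
  MeasurableSpace.comap Draw.cov inferInstance

theorem sigmaX_le : sigmaX d ≤ (inferInstance : MeasurableSpace (Draw d)) :=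
  measurable_cov.comap_le

/-! ### Assumptions on the data generating process -/

/-- External validity: the target population has, as its law `Q` of `(Y₁, Y₀, X)`, the marginal
of the data generating process. -/
def ExternalValidity (P : Measure (Draw d)) (Q : Measure (ℝ × ℝ × Cov d)) : Prop :=
  Q = P.map fun w => (Draw.y1 w, Draw.y0 w, Draw.cov w)

/-- Unconfoundedness: `(Y₁, Y₀)` and `D` are independent conditionally on `X`. -/
def Unconfounded (P : Measure (Draw d)) [IsFiniteMeasure P] : Prop :=
  CondIndepFun (sigmaX d) sigmaX_le (fun w => (Draw.y1 w, Draw.y0 w)) Draw.treat P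

/-- Bounded outcomes: the observed outcome `Y` is supported in `[0, B]`. -/
def BoundedOutcomes (P : Measure (Draw d)) (B : ℝ) : Prop :=
  ∀ᵐ w ∂P, (observe w).1 ∈ Icc 0 B

/-- `e` is the propensity score: a measurable function with `e(X) = E(D | X)`. -/
def IsPropensityScore (P : Measure (Draw d)) (e : Cov d → ℝ) : Prop :=
  Measurable e ∧
    (fun w => e (Draw.cov w)) =ᵐ[P] P[(fun w => if Draw.treat w then (1 : ℝ) else 0) | sigmaX d]

/-- Strict overlap on the set `𝒳` in which the covariates take their values. -/
def StrictOverlap (𝒳 : Set (Cov d)) (e : Cov d → ℝ) (ψ : ℝ) : Prop :=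
  ∀ x ∈ 𝒳, e x ∈ Icc ψ (1 - ψ)

/-! ### Linear Eligibility Score rules -/

/-- The unit hypersphere of `ℝ^m`, `m = d + 1`, whose points `β = (γ, c)` index the rules: `γ` is
given by the first `d` coordinates and the threshold `c` is the last one. -/
abbrev Sph (d : ℕ) : Type := Metric.sphere (0 : EuclideanSpace ℝ (Fin (d + 1))) 1

/-- The score `x'γ - c` of `x` under `β = (γ, c)`, i.e. the inner product of `β` with the
covariate vector `x` completed by the constant `-1`. -/
def score (β : Sph d) (x : Cov d) : ℝ :=
  (∑ j : Fin d, x j * β.1 (Fin.castSucc j)) - β.1 (Fin.last d)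

open Classical in
/-- The rule `f_β(x) = 1{x'γ ≥ c}`. -/
def rule (β : Sph d) (x : Cov d) : Bool := decide (0 ≤ score β x)

/-- The margin assumption with constant `c`. -/
def MarginCondition (P : Measure (Draw d)) (c : ℝ) : Prop :=
  ∀ β₁ β₂ : Sph d,
    P.real {w | score β₁ (Draw.cov w) * score β₂ (Draw.cov w) ≤ 0} ≤ c * ‖β₁.1 - β₂.1‖

/-! ### Welfare risk -/

/-- The weight `H = (Y ψ / B) / (e(X) D + (1 - e(X)) (1 - D))`. -/
def weight (e : Cov d → ℝ) (ψ B : ℝ) (z : Obs d) : ℝ :=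
  z.1 * (ψ / B) / (if z.2.1 then e z.2.2 else 1 - e z.2.2)

/-- The loss `H · 1{f_β(X) ≠ D}`. -/
def loss (e : Cov d → ℝ) (ψ B : ℝ) (β : Sph d) (z : Obs d) : ℝ :=
  if rule β z.2.2 ≠ z.2.1 then weight e ψ B z else 0

/-- The welfare risk `R(β)`. -/
def risk (P : Measure (Draw d)) (e : Cov d → ℝ) (ψ B : ℝ) (β : Sph d) : ℝ :=
  ∫ z, loss e ψ B β z ∂(obsLaw P)

/-- The empirical welfare risk `R_S(β)`. -/
def empRisk (e : Cov d → ℝ) (ψ B : ℝ) {n : ℕ} (S : Fin n → Obs d) (β : Sph d) : ℝ :=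
  (1 / n : ℝ) * ∑ i, loss e ψ B β (S i)

/-- The expected welfare risk `R^Λ` of a distribution `Λ` over rules. -/
def expRisk (P : Measure (Draw d)) (e : Cov d → ℝ) (ψ B : ℝ) (Λ : Measure (Sph d)) : ℝ :=
  ∫ β, risk P e ψ B β ∂Λ

/-- The empirical version `R_S^Λ` of the expected welfare risk. -/
def empExpRisk (e : Cov d → ℝ) (ψ B : ℝ) {n : ℕ} (S : Fin n → Obs d)
    (Λ : Measure (Sph d)) : ℝ :=
  ∫ β, empRisk e ψ B S β ∂Λ

/-- `R̄`, the infimum of `R^Λ` over all probability distributions `Λ` over rules. -/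
def optRisk (P : Measure (Draw d)) (e : Cov d → ℝ) (ψ B : ℝ) : ℝ :=
  ⨅ Λ : ProbabilityMeasure (Sph d), expRisk P e ψ B (Λ : Measure (Sph d))

/-! ### Prior, variational family and variational posterior -/

/-- The surface measure on the unit hypersphere. -/
def surface (d : ℕ) : Measure (Sph d) :=
  (volume : Measure (EuclideanSpace ℝ (Fin (d + 1)))).toSphere

/-- The uniform prior on the unit hypersphere. -/
def uniformPrior (d : ℕ) : Measure (Sph d) := (surface d univ)⁻¹ • surface d

/-- The modified Bessel function of the first kind and order `ν`, at `x > 0`. -/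
def besselI (ν x : ℝ) : ℝ :=
  ∑' k : ℕ, (x / 2) ^ (2 * (k : ℝ) + ν) / ((k.factorial : ℝ) * Real.Gamma (k + ν + 1))

/-- The von Mises–Fisher distribution with concentration `κ > 0` and mean direction `μ`: it has
density `κ^(m/2-1) exp(κ μ'β) / ((2π)^(m/2) I_{m/2-1}(κ))`, with `m = d + 1`, with respect to
the surface measure. -/
def vonMisesFisher (κ : ℝ) (μ : Sph d) : Measure (Sph d) :=
  (surface d).withDensity fun β => ENNReal.ofReal
    (κ ^ (((d : ℝ) + 1) / 2 - 1) * Real.exp (κ * inner ℝ μ.1 β.1) /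
      ((2 * Real.pi) ^ (((d : ℝ) + 1) / 2) * besselI (((d : ℝ) + 1) / 2 - 1) κ))

/-- The variational family: all von Mises–Fisher distributions. -/
def vmfFamily (d : ℕ) : Set (Measure (Sph d)) :=
  {Λ | ∃ κ : ℝ, 0 < κ ∧ ∃ μ : Sph d, Λ = vonMisesFisher κ μ}

/-- The criterion `R_S^Λ + √((KL(Λ ‖ π₀) + ln(2√n/ε)) / (2n))`. It is only used for
`Λ ∈ vmfFamily d`, for which the divergence is finite. -/
def criterion (e : Cov d → ℝ) (ψ B ε : ℝ) {n : ℕ} (S : Fin n → Obs d)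
    (Λ : Measure (Sph d)) : ℝ :=
  empExpRisk e ψ B S Λ +
    √(1 / (2 * n) *
      ((InformationTheory.klDiv Λ (uniformPrior d)).toReal + Real.log (2 * √n / ε)))

/-- `Λ` minimises the criterion over the von Mises–Fisher family up to `δ`. For `δ = 0`, `Λ` is an
exact minimiser, that is, a variational posterior. -/
def IsVariationalPosterior (e : Cov d → ℝ) (ψ B ε : ℝ) {n : ℕ} (S : Fin n → Obs d) (δ : ℝ)
    (Λ : Measure (Sph d)) : Prop :=
  Λ ∈ vmfFamily d ∧
    ∀ Λ' ∈ vmfFamily d, criterion e ψ B ε S Λ ≤ criterion e ψ B ε S Λ' + δ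

/-- The constant of the regret bound; `c` is the margin constant, `m = d + 1`, `ν = m/2 - 1`. -/
def regretConst (d : ℕ) (c ε : ℝ) : ℝ :=
  let ν : ℝ := ((d : ℝ) + 1) / 2 - 1
  4 * c * √(ν + 1) + 1 + (ν + 1 / 2) * (Real.log 9 / Real.log 8)
    + Real.log (2 * Real.exp 1 / ε)
    + √((ν + 1 / 2) * Real.log 9 / (2 * Real.log 8))
    + √(1 / 2 * Real.log (4 * Real.exp 1 / ε))
    + √(Real.log 8) / (√2 * Real.log 8)

end

end WelfareRegret

open WelfareRegret

/-! Write m = d + 1, Δ = R − R_S, and let T(Λ) be the square-root penalty in the criterion. The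
proof combines a uniform PAC-Bayes bound with a good competitor inside the von Mises–Fisher family.

Uniform bound: the loss lies in [0, 1], so Δ(β) is sub-Gaussian with variance proxy 1/(4n) and
exp((2n − 1/2)Δ²) has mean at most 2√n. Averaging over the prior and applying Markov's inequality
gives one event of probability at least 1 − ε. On it, Donsker–Varadhan and Jensen bound |R^Λ −
R_S^Λ| for every Λ in the family at once (`abs_expRisk_sub_empExpRisk_le`). The bound is at most (1
+ 1/(7n)) T(Λ), because 2n − 1/2 is nearly 2n.

Competitor: the margin condition makes R Lipschitz with constant c, so R attains its minimum at some
β on the compact sphere. Take Λ₀ with mean direction β and κ = n. It is an exponential tilt of the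
prior, so KL(Λ₀ ‖ π₀) + (n/2) E‖β − β'‖² equals n − log ∫ exp(n β'b) dπ₀(b). The mass of a small cap
bounds this by 1 + m ln n. Hence the penalty of Λ₀ and its excess risk c·E‖β − β'‖ are both O(ln n /
√n).

Near-minimality of Λ against Λ₀ joins the two parts; what remains is fitting the constants into M.
-/

instance isFiniteMeasure_surface (d : ℕ) : IsFiniteMeasure (surface d) := by
  unfold surface
  infer_instance

/-! ### Moments of the surface measure and the Bessel normalising constant -/

theorem integral_Ioi_pow_mul_exp_neg_sq_div_two (p : ℕ) :
    ∫ r in Ioi (0 : ℝ), r ^ p * Real.exp (-(r ^ 2) / 2)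
      = 2 ^ (((p : ℝ) - 1) / 2) * Real.Gamma (((p : ℝ) + 1) / 2) := by
  have h := integral_rpow_mul_exp_neg_mul_rpow (p := 2) (q := p) (b := 1 / 2) two_pos
    (by have : (0 : ℝ) ≤ p := p.cast_nonneg
        linarith) (by norm_num)
  have h2 : ∫ r in Ioi (0 : ℝ), r ^ p * Real.exp (-(r ^ 2) / 2)
      = ∫ x in Ioi (0 : ℝ), x ^ (p : ℝ) * Real.exp (-(1 / 2) * x ^ (2 : ℝ)) := by
    refine setIntegral_congr_fun measurableSet_Ioi fun x _ => ?_
    simp only [Real.rpow_natCast, Real.rpow_two]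
    congr 2
    ring
  rw [h2, h]
  congr 1
  rw [one_div, Real.inv_rpow two_pos.le, ← Real.rpow_neg two_pos.le]
  rw [show (2 : ℝ)⁻¹ = 2 ^ (-1 : ℝ) by rw [Real.rpow_neg_one], ← Real.rpow_add two_pos]
  congr 1
  ring

theorem integral_pow_even_mul_exp_neg_sq_div_two (k : ℕ) :
    ∫ y : ℝ, y ^ (2 * k) * Real.exp (-(y ^ 2) / 2)
      = 2 ^ ((k : ℝ) + 1 / 2) * Real.Gamma ((k : ℝ) + 1 / 2) := by
  have h := integral_comp_abs (f := fun y : ℝ => y ^ (2 * k) * Real.exp (-(y ^ 2) / 2))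
  have h1 : ∀ y : ℝ, |y| ^ (2 * k) = y ^ (2 * k) := fun y => (even_two_mul k).pow_abs y
  simp only [h1, sq_abs] at h
  rw [h, integral_Ioi_pow_mul_exp_neg_sq_div_two, ← mul_assoc]
  congr 1
  · nth_rw 1 [show (2 : ℝ) = 2 ^ (1 : ℝ) by simp]
    rw [← Real.rpow_add two_pos]
    congr 1
    push_cast
    ring
  · congr 1
    push_cast
    ring

theorem integral_pow_odd_mul_exp_neg_sq_div_two (k : ℕ) :
    ∫ y : ℝ, y ^ (2 * k + 1) * Real.exp (-(y ^ 2) / 2) = 0 := by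
  have h := integral_neg_eq_self (fun y : ℝ => y ^ (2 * k + 1) * Real.exp (-(y ^ 2) / 2)) volume
  have h1 : ∀ y : ℝ, (-y) ^ (2 * k + 1) * Real.exp (-((-y) ^ 2) / 2)
      = -(y ^ (2 * k + 1) * Real.exp (-(y ^ 2) / 2)) := fun y => by
    rw [Odd.neg_pow ⟨k, rfl⟩, neg_sq]
    ring
  simp only [h1, integral_neg] at h
  linarith

/-- In an orthonormal basis whose first vector is μ the integrand is a product of functions of
single coordinates. Polar coordinates evaluate the same integral in the next lemma, and comparing
the two yields the moments of μ'β on the sphere. -/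
theorem integral_inner_pow_mul_exp_neg_norm_sq {d : ℕ} (μ : Sph d) (j : ℕ) :
    ∫ x : EuclideanSpace ℝ (Fin (d + 1)), (inner ℝ μ.1 x) ^ j * Real.exp (-(‖x‖ ^ 2) / 2)
      = (∫ y : ℝ, y ^ j * Real.exp (-(y ^ 2) / 2)) * (2 * Real.pi) ^ ((d : ℝ) / 2) := by
  have hμ : ‖μ.1‖ = 1 := by simp
  obtain ⟨b, hb⟩ : ∃ b : OrthonormalBasis (Fin (d + 1)) ℝ (EuclideanSpace ℝ (Fin (d + 1))),
      ∀ i ∈ ({0} : Set (Fin (d + 1))), b i = (fun _ => μ.1) i := by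
    refine Orthonormal.exists_orthonormalBasis_extension_of_card_eq (by simp) ?_
    refine ⟨fun i => by simp, fun i i' hii => ?_⟩
    exact absurd (Subsingleton.elim i i') hii
  have hb0 : b 0 = μ.1 := hb 0 rfl
  have hmp : MeasurePreserving (fun y : Fin (d + 1) → ℝ => b.repr.symm (WithLp.toLp 2 y)) :=
    b.measurePreserving_repr_symm.comp (PiLp.volume_preserving_toLp (Fin (d + 1)))
  have hemb : MeasurableEmbedding
      (fun y : Fin (d + 1) → ℝ => b.repr.symm (WithLp.toLp 2 y)) :=
    b.repr.symm.toHomeomorph.measurableEmbedding.comp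
      (MeasurableEquiv.toLp 2 (Fin (d + 1) → ℝ)).measurableEmbedding
  rw [← hmp.integral_comp hemb]
  have hg : ∫ y : ℝ, Real.exp (-(y ^ 2) / 2) = √(2 * Real.pi) := by
    have := integral_gaussian (1 / 2)
    rw [show Real.pi / (1 / 2) = 2 * Real.pi by ring] at this
    rw [← this]
    congr with y
    ring_nf
  have hpt : ∀ y : Fin (d + 1) → ℝ,
      (inner ℝ μ.1 (b.repr.symm (WithLp.toLp 2 y))) ^ j
        * Real.exp (-(‖b.repr.symm (WithLp.toLp 2 y)‖ ^ 2) / 2)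
      = ∏ i, (if i = 0 then fun t : ℝ => t ^ j * Real.exp (-(t ^ 2) / 2)
          else fun t : ℝ => Real.exp (-(t ^ 2) / 2)) (y i) := by
    intro y
    have h1 : inner ℝ μ.1 (b.repr.symm (WithLp.toLp 2 y)) = y 0 := by
      rw [← hb0, ← b.repr_apply_apply]
      simp
    have h2 : ‖b.repr.symm (WithLp.toLp 2 y)‖ ^ 2 = ∑ i, y i ^ 2 := by
      rw [LinearIsometryEquiv.norm_map, EuclideanSpace.norm_sq_eq]
      simp
    rw [h1, h2, Fin.prod_univ_succ, Fin.sum_univ_succ]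
    simp only [if_true, Fin.succ_ne_zero, if_false]
    rw [← Real.exp_sum, mul_assoc, ← Real.exp_add]
    congr 2
    rw [← Finset.sum_div, Finset.sum_neg_distrib]
    ring
  simp only [hpt]
  rw [integral_fintype_prod_volume_eq_prod, Fin.prod_univ_succ]
  simp only [if_true, Fin.succ_ne_zero, if_false, hg, Finset.prod_const, Finset.card_univ,
    Fintype.card_fin]
  congr 1
  rw [Real.sqrt_eq_rpow, ← Real.rpow_natCast, ← Real.rpow_mul (by positivity)]
  congr 1
  ring

theorem integral_inner_pow_mul_exp_neg_norm_sq_eq_surface {d : ℕ} (μ : Sph d) (j : ℕ) :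
    ∫ x : EuclideanSpace ℝ (Fin (d + 1)), (inner ℝ μ.1 x) ^ j * Real.exp (-(‖x‖ ^ 2) / 2)
      = (∫ β, (inner ℝ μ.1 β.1) ^ j ∂(surface d))
        * ∫ r in Ioi (0 : ℝ), r ^ (d + j) * Real.exp (-(r ^ 2) / 2) := by
  set f : EuclideanSpace ℝ (Fin (d + 1)) → ℝ :=
    fun x => (inner ℝ μ.1 x) ^ j * Real.exp (-(‖x‖ ^ 2) / 2) with hf
  have hdim : Module.finrank ℝ (EuclideanSpace ℝ (Fin (d + 1))) - 1 = d := by simp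
  calc ∫ x, f x = ∫ x : ({(0)}ᶜ : Set (EuclideanSpace ℝ (Fin (d + 1)))), f x.1
        ∂(volume.comap Subtype.val) := by
        rw [integral_subtype_comap (measurableSet_singleton _).compl f, restrict_compl_singleton]
    _ = ∫ z : Sph d × Ioi (0 : ℝ), (inner ℝ μ.1 z.1.1) ^ j *
          (z.2.1 ^ j * Real.exp (-(z.2.1 ^ 2) / 2))
          ∂((surface d).prod (Measure.volumeIoiPow d)) := by
        have hmp := (volume : Measure (EuclideanSpace ℝ (Fin (d + 1))))
          |>.measurePreserving_homeomorphUnitSphereProd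
        rw [hdim] at hmp
        rw [surface, ← hmp.integral_comp (Homeomorph.measurableEmbedding _)]
        refine integral_congr_ae (.of_forall fun x => ?_)
        have hx : ‖x.1‖ ≠ 0 := norm_ne_zero_iff.2 x.2
        simp only [hf, homeomorphUnitSphereProd_apply_snd_coe,
          homeomorphUnitSphereProd_apply_fst_coe, inner_smul_right]
        rw [← mul_assoc, ← mul_pow]
        congr 2
        field_simp
    _ = (∫ β, (inner ℝ μ.1 β.1) ^ j ∂(surface d))
        * ∫ r : Ioi (0 : ℝ), r.1 ^ j * Real.exp (-(r.1 ^ 2) / 2) ∂(Measure.volumeIoiPow d) :=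
        integral_prod_mul (fun β : Sph d => (inner ℝ μ.1 β.1) ^ j)
          (fun r : Ioi (0 : ℝ) => r.1 ^ j * Real.exp (-(r.1 ^ 2) / 2))
    _ = _ := by
        congr 1
        simp only [Measure.volumeIoiPow, ENNReal.ofReal]
        rw [integral_withDensity_eq_integral_smul,
          integral_subtype_comap measurableSet_Ioi fun a : ℝ =>
            Real.toNNReal (a ^ d) • (a ^ j * Real.exp (-(a ^ 2) / 2))]
        · refine setIntegral_congr_fun measurableSet_Ioi fun x hx => ?_
          rw [NNReal.smul_def, Real.coe_toNNReal _ (pow_nonneg (le_of_lt hx) _), smul_eq_mul]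
          ring
        · exact (measurable_subtype_coe.pow_const _).real_toNNReal

theorem integral_surface_inner_pow_odd {d : ℕ} (μ : Sph d) (k : ℕ) :
    ∫ β, (inner ℝ μ.1 β.1) ^ (2 * k + 1) ∂(surface d) = 0 := by
  have h := integral_inner_pow_mul_exp_neg_norm_sq_eq_surface μ (2 * k + 1)
  rw [integral_inner_pow_mul_exp_neg_norm_sq, integral_pow_odd_mul_exp_neg_sq_div_two, zero_mul,
    integral_Ioi_pow_mul_exp_neg_sq_div_two] at h
  refine (mul_eq_zero.1 h.symm).resolve_right (mul_pos (by positivity) ?_).ne'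
  exact Real.Gamma_pos_of_pos (by positivity)

theorem integral_surface_inner_pow_even {d : ℕ} (μ : Sph d) (k : ℕ) :
    ∫ β, (inner ℝ μ.1 β.1) ^ (2 * k) ∂(surface d)
      = (2 * k).factorial * (2 * Real.pi) ^ (((d : ℝ) + 1) / 2)
        * ((1 / 2) ^ (2 * (k : ℝ) + (((d : ℝ) + 1) / 2 - 1))
          / (k.factorial * Real.Gamma (k + (((d : ℝ) + 1) / 2 - 1) + 1))) := by
  have h := integral_inner_pow_mul_exp_neg_norm_sq_eq_surface μ (2 * k)
  rw [integral_inner_pow_mul_exp_neg_norm_sq, integral_pow_even_mul_exp_neg_sq_div_two,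
    integral_Ioi_pow_mul_exp_neg_sq_div_two] at h
  have hG : Real.Gamma ((((d + 2 * k : ℕ) : ℝ) + 1) / 2)
      = Real.Gamma (k + (((d : ℝ) + 1) / 2 - 1) + 1) := by
    congr 1
    push_cast
    ring
  have hGpos : 0 < Real.Gamma (k + (((d : ℝ) + 1) / 2 - 1) + 1) := by
    rw [← hG]
    exact Real.Gamma_pos_of_pos (by positivity)
  -- Legendre duplication trades Γ(k + 1/2) for (2k)!/k!. The (2k)! later cancels against the
  -- exponential series, leaving the k-th Bessel term.
  have hdup := Real.Gamma_mul_Gamma_add_half ((k : ℝ) + 1 / 2)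
  rw [show (k : ℝ) + 1 / 2 + 1 / 2 = k + 1 by ring, Real.Gamma_nat_eq_factorial,
    show 2 * ((k : ℝ) + 1 / 2) = ((2 * k : ℕ) : ℝ) + 1 by push_cast; ring,
    Real.Gamma_nat_eq_factorial] at hdup
  have hk : (k.factorial : ℝ) ≠ 0 := by positivity
  have hdup' : Real.Gamma ((k : ℝ) + 1 / 2)
      = (2 * k).factorial * 2 ^ (1 - (((2 * k : ℕ) : ℝ) + 1)) * √Real.pi / k.factorial := by
    rw [eq_div_iff hk, hdup]
  rw [hG, hdup'] at h
  have h2 : (0 : ℝ) < 2 ^ ((((d + 2 * k : ℕ) : ℝ) - 1) / 2) := by positivity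
  rw [← mul_assoc] at h
  rw [← mul_div_assoc, eq_div_iff (by positivity)]
  apply mul_right_cancel₀ h2.ne'
  rw [eq_comm] at h
  set I := ∫ β, (inner ℝ μ.1 β.1) ^ (2 * k) ∂(surface d)
  set G := Real.Gamma (k + (((d : ℝ) + 1) / 2 - 1) + 1)
  have e1 : (2 : ℝ) ^ ((k : ℝ) + 1 / 2) * 2 ^ (1 - (((2 * k : ℕ) : ℝ) + 1)) * √Real.pi
        * (2 * Real.pi) ^ ((d : ℝ) / 2)
      = (2 * Real.pi) ^ (((d : ℝ) + 1) / 2)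
        * (1 / 2) ^ (2 * (k : ℝ) + (((d : ℝ) + 1) / 2 - 1))
        * 2 ^ ((((d + 2 * k : ℕ) : ℝ) - 1) / 2) := by
    rw [Real.mul_rpow two_pos.le Real.pi_pos.le, Real.mul_rpow two_pos.le Real.pi_pos.le,
      Real.sqrt_eq_rpow, one_div, Real.inv_rpow two_pos.le, ← Real.rpow_neg two_pos.le,
      add_div (d : ℝ), Real.rpow_add Real.pi_pos]
    have e2 : (2 : ℝ) ^ ((k : ℝ) + 2⁻¹) * 2 ^ (1 - (((2 * k : ℕ) : ℝ) + 1)) * 2 ^ ((d : ℝ) / 2)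
        = 2 ^ ((d : ℝ) / 2 + 1 / 2) * 2 ^ (-(2 * (k : ℝ) + ((d : ℝ) / 2 + 1 / 2 - 1)))
          * 2 ^ ((((d + 2 * k : ℕ) : ℝ) - 1) / 2) := by
      simp only [← Real.rpow_add two_pos]
      congr 1
      push_cast
      ring
    simp only [one_div] at e2 ⊢
    linear_combination (Real.pi ^ ((2 : ℝ)⁻¹) * Real.pi ^ ((d : ℝ) / 2)) * e2
  calc I * (k.factorial * G) * 2 ^ ((((d + 2 * k : ℕ) : ℝ) - 1) / 2)
      = k.factorial * (I * 2 ^ ((((d + 2 * k : ℕ) : ℝ) - 1) / 2) * G) := by ring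
    _ = (2 * k).factorial * ((2 : ℝ) ^ ((k : ℝ) + 1 / 2) * 2 ^ (1 - (((2 * k : ℕ) : ℝ) + 1))
        * √Real.pi * (2 * Real.pi) ^ ((d : ℝ) / 2)) := by
        rw [h]
        field_simp
    _ = _ := by
        rw [e1]
        ring

theorem abs_inner_sphere_le_one {d : ℕ} (μ β : Sph d) : |inner ℝ μ.1 β.1| ≤ 1 := by
  simpa using abs_real_inner_le_norm μ.1 β.1

theorem continuous_inner_sphere {d : ℕ} (μ : Sph d) :
    Continuous fun β : Sph d => (inner ℝ μ.1 β.1 : ℝ) := by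
  fun_prop

/-- Since |μ'β| ≤ 1, the exponential series is dominated termwise by |κ|^j / j!, which permits
integration term by term. -/
theorem hasSum_integral_exp_inner {d : ℕ} (μ : Sph d) (κ : ℝ) :
    HasSum (fun j : ℕ => κ ^ j / j.factorial * ∫ β, (inner ℝ μ.1 β.1) ^ j ∂(surface d))
      (∫ β, Real.exp (κ * inner ℝ μ.1 β.1) ∂(surface d)) := by
  have h := hasSum_integral_of_dominated_convergence (μ := surface d)
    (F := fun (j : ℕ) (β : Sph d) => κ ^ j / j.factorial * (inner ℝ μ.1 β.1) ^ j)
    (f := fun β => Real.exp (κ * inner ℝ μ.1 β.1))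
    (fun j _ => |κ| ^ j / j.factorial)
    (fun j => (((continuous_inner_sphere μ).pow j).const_mul _).aestronglyMeasurable)
    (fun j => .of_forall fun β => ?_)
    (.of_forall fun β => Real.summable_pow_div_factorial |κ|)
    (integrable_const _)
    (.of_forall fun β => ?_)
  · simpa only [integral_const_mul] using h
  · rw [norm_mul, norm_div, norm_pow, norm_pow, Real.norm_natCast, Real.norm_eq_abs,
      Real.norm_eq_abs]
    exact mul_le_of_le_one_right (by positivity)
      (pow_le_one₀ (abs_nonneg _) (abs_inner_sphere_le_one μ β))
  · have := NormedSpace.expSeries_div_hasSum_exp (κ * inner ℝ μ.1 β.1)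
    rw [← Real.exp_eq_exp_ℝ] at this
    simpa only [mul_pow, mul_div_right_comm] using this

/-- The normalising constant of the von Mises–Fisher density. -/
theorem integral_exp_inner_surface {d : ℕ} (μ : Sph d) {κ : ℝ} (hκ : 0 < κ) :
    κ ^ (((d : ℝ) + 1) / 2 - 1) * ∫ β, Real.exp (κ * inner ℝ μ.1 β.1) ∂(surface d)
      = (2 * Real.pi) ^ (((d : ℝ) + 1) / 2) * besselI (((d : ℝ) + 1) / 2 - 1) κ := by
  have h := hasSum_integral_exp_inner μ κ
  have hinj : Function.Injective fun k : ℕ => 2 * k := fun a b hab => by simpa using hab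
  rw [← hinj.hasSum_iff] at h
  · rw [← h.tsum_eq, besselI, ← tsum_mul_left, ← tsum_mul_left]
    congr with k
    simp only [Function.comp_apply]
    rw [integral_surface_inner_pow_even, div_eq_mul_one_div κ 2,
      Real.mul_rpow hκ.le (by norm_num), Real.rpow_add hκ,
      show (2 * (k : ℝ)) = ((2 * k : ℕ) : ℝ) by push_cast; rfl, Real.rpow_natCast]
    have : ((2 * k).factorial : ℝ) ≠ 0 := by positivity
    field_simp
  · intro j hj
    obtain ⟨k, rfl | rfl⟩ := Nat.even_or_odd' j
    · exact absurd ⟨k, rfl⟩ hj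
    · rw [integral_surface_inner_pow_odd, mul_zero]

/-! ### Relative entropy and exponential tilting -/

/-- The Donsker–Varadhan inequality. -/
theorem integral_le_toReal_klDiv_add_log {α : Type*} [MeasurableSpace α] {Λ π : Measure α}
    [IsProbabilityMeasure Λ] [IsProbabilityMeasure π] (hΛ : Λ ≪ π)
    (hllr : Integrable (llr Λ π) Λ) {φ : α → ℝ} (hφ : Integrable φ Λ)
    (hexp : Integrable (fun x => Real.exp (φ x)) π) :
    ∫ x, φ x ∂Λ ≤ (InformationTheory.klDiv Λ π).toReal + Real.log (∫ x, Real.exp (φ x) ∂π) := by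
  have := isProbabilityMeasure_tilted hexp
  have h1 := integral_llr_tilted_right hΛ hφ hexp hllr
  -- The inequality is the nonnegativity of the divergence of Λ from π tilted by φ.
  have h2 := InformationTheory.integral_llr_add_sub_measure_univ_nonneg
    (hΛ.trans (absolutelyContinuous_tilted hexp))
    (integrable_llr_tilted_right hΛ hφ hllr hexp)
  rw [InformationTheory.toReal_klDiv_of_measure_eq hΛ (by simp)]
  simp only [probReal_univ] at h2
  linarith

theorem llr_tilted_self {α : Type*} [MeasurableSpace α] {π : Measure α} [IsProbabilityMeasure π]
    {f : α → ℝ} (hexp : Integrable (fun x => Real.exp (f x)) π) :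
    llr (π.tilted f) π =ᵐ[π.tilted f] fun x => f x - Real.log (∫ x, Real.exp (f x) ∂π) :=
  (tilted_absolutelyContinuous π f).ae_eq (log_rnDeriv_tilted_left_self hexp)

theorem toReal_klDiv_tilted {α : Type*} [MeasurableSpace α] {π : Measure α}
    [IsProbabilityMeasure π] {f : α → ℝ} (hexp : Integrable (fun x => Real.exp (f x)) π)
    (hf : Integrable f (π.tilted f)) :
    (InformationTheory.klDiv (π.tilted f) π).toReal
      = ∫ x, f x ∂(π.tilted f) - Real.log (∫ x, Real.exp (f x) ∂π) := by
  have := isProbabilityMeasure_tilted hexp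
  rw [InformationTheory.toReal_klDiv_of_measure_eq (tilted_absolutelyContinuous π f) (by simp),
    integral_congr_ae (llr_tilted_self hexp), integral_sub hf (integrable_const _)]
  simp

/-! ### Von Mises–Fisher laws: divergence from the prior and concentration -/

instance isProbabilityMeasure_uniformPrior (d : ℕ) : IsProbabilityMeasure (uniformPrior d) := by
  have : NeZero (surface d) := ⟨by
    unfold surface
    exact Measure.toSphere_ne_zero _⟩
  unfold uniformPrior
  infer_instance

theorem integrable_exp_inner {d : ℕ} (μ : Sph d) (κ : ℝ) (Λ : Measure (Sph d))
    [IsFiniteMeasure Λ] : Integrable (fun β : Sph d => Real.exp (κ * inner ℝ μ.1 β.1)) Λ :=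
  (Real.continuous_exp.comp
    ((continuous_inner_sphere μ).const_mul κ)).integrable_of_hasCompactSupport
    (HasCompactSupport.of_compactSpace _)

theorem integrable_mul_inner {d : ℕ} (μ : Sph d) (κ : ℝ) (Λ : Measure (Sph d))
    [IsFiniteMeasure Λ] : Integrable (fun β : Sph d => κ * inner ℝ μ.1 β.1) Λ :=
  ((continuous_inner_sphere μ).const_mul κ).integrable_of_hasCompactSupport
    (HasCompactSupport.of_compactSpace _)

/-- The Bessel factor is exactly the normaliser of exp(κ μ'β). From here on only the tilt is used
and Bessel functions disappear. -/
theorem vonMisesFisher_eq_tilted {d : ℕ} {κ : ℝ} (hκ : 0 < κ) (μ : Sph d) :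
    vonMisesFisher κ μ = (uniformPrior d).tilted fun β => κ * inner ℝ μ.1 β.1 := by
  have h0 : surface d univ ≠ 0 := by
    unfold surface
    simpa using (Metric.measure_ball_pos volume (0 : EuclideanSpace ℝ (Fin (d + 1))) one_pos).ne'
  have hI := integral_exp_inner_surface μ hκ
  have hc : 0 < ((surface d univ)⁻¹).toReal :=
    ENNReal.toReal_pos (by simp) (by simpa using h0)
  have hc' : (surface d univ)⁻¹ ≠ ∞ := by simpa using h0
  have hκp : 0 < κ ^ (((d : ℝ) + 1) / 2 - 1) := by positivity
  have hne : surface d ≠ 0 := fun h => h0 (by simp [h])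
  have : NeZero (surface d) := ⟨hne⟩
  have hIpos := integral_exp_pos (integrable_exp_inner μ κ (surface d))
  unfold vonMisesFisher Measure.tilted
  rw [← hI]
  unfold uniformPrior
  rw [integral_smul_measure, withDensity_smul_measure, ← withDensity_smul']
  · congr with β
    rw [Pi.smul_apply, smul_eq_mul, ← ENNReal.ofReal_toReal hc', ← ENNReal.ofReal_mul hc.le,
      ENNReal.toReal_ofReal hc.le, smul_eq_mul]
    congr 1
    field_simp
  · exact hc'

theorem isProbabilityMeasure_vonMisesFisher {d : ℕ} {κ : ℝ} (hκ : 0 < κ) (μ : Sph d) :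
    IsProbabilityMeasure (vonMisesFisher κ μ) := by
  rw [vonMisesFisher_eq_tilted hκ]
  exact isProbabilityMeasure_tilted (integrable_exp_inner μ κ _)

/-- The general cap bound is m (r/4)^m vol(unit ball), and the whole sphere has surface m vol(unit
ball). The exponent m, not the sharp m − 1, is enough for a logarithmic rate. -/
theorem uniformPrior_real_ball_ge {d : ℕ} (μ : Sph d) {r : ℝ} (hr : 0 < r) (hr2 : r ≤ 2) :
    (r / 4) ^ (d + 1) ≤ (uniformPrior d).real (Metric.ball μ r) := by
  have h := (volume : Measure (EuclideanSpace ℝ (Fin (d + 1))))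
    |>.toSphereBallBound_mul_measureReal_unitBall_le_toSphere_ball hr μ
  have hu := (volume : Measure (EuclideanSpace ℝ (Fin (d + 1)))).toSphere_real_apply_univ
  have hb : 0 < (volume : Measure (EuclideanSpace ℝ (Fin (d + 1)))).real (Metric.ball 0 1) :=
    ENNReal.toReal_pos (Metric.measure_ball_pos _ _ one_pos).ne' measure_ball_lt_top.ne
  have hbd : ((Measure.toSphereBallBound (d + 1) r : NNReal) : ℝ)
      = ((d : ℝ) + 1) * (r / 4) ^ (d + 1) := by
    unfold Measure.toSphereBallBound
    rw [if_pos ⟨by simp, hr⟩, min_eq_left (Real.toNNReal_le_iff_le_coe.2 (by simpa using hr2))]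
    simp [hr.le]
  rw [finrank_euclideanSpace_fin] at h hu
  rw [hbd] at h
  unfold uniformPrior
  rw [measureReal_ennreal_smul_apply, ENNReal.toReal_inv]
  change _ ≤ ((surface d).real univ)⁻¹ * _
  unfold surface
  rw [hu, inv_mul_eq_div, le_div_iff₀ (by positivity)]
  push_cast
  linarith

theorem norm_sub_sq_sphere {d : ℕ} (μ β : Sph d) :
    ‖μ.1 - β.1‖ ^ 2 = 2 * (1 - inner ℝ μ.1 β.1) := by
  rw [norm_sub_sq_real]
  simp
  ring

/-- A lower bound for the Laplace transform of `1 - μ'β` under the uniform distribution. -/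
theorem sub_log_integral_exp_inner_le {d : ℕ} (μ : Sph d) {κ : ℝ} (hκ : 8 ≤ κ) :
    κ - Real.log (∫ β, Real.exp (κ * inner ℝ μ.1 β.1) ∂(uniformPrior d))
      ≤ 1 + (d + 1) * Real.log κ := by
  have hκ0 : 0 < κ := by linarith
  -- Radius 4/κ gives cap mass at least κ^(−m), while κ(1 − μ'β) = κ‖μ − β‖²/2 ≤ 8/κ ≤ 1 on the cap.
  have hr : 0 < 4 / κ := by positivity
  have hr2 : 4 / κ ≤ 2 := by rw [div_le_iff₀ hκ0]; linarith
  have hcap := uniformPrior_real_ball_ge μ hr hr2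
  have hint := integrable_exp_inner μ κ (uniformPrior d)
  have hlow : Real.exp (κ - 1) * (1 / κ) ^ (d + 1)
      ≤ ∫ β, Real.exp (κ * inner ℝ μ.1 β.1) ∂(uniformPrior d) := by
    calc Real.exp (κ - 1) * (1 / κ) ^ (d + 1)
        ≤ Real.exp (κ - 1) * (uniformPrior d).real (Metric.ball μ (4 / κ)) := by
          refine mul_le_mul_of_nonneg_left ?_ (Real.exp_pos _).le
          rwa [show 1 / κ = 4 / κ / 4 by ring]
      _ = ∫ β in Metric.ball μ (4 / κ), Real.exp (κ - 1) ∂(uniformPrior d) := by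
          rw [setIntegral_const, smul_eq_mul, mul_comm]
      _ ≤ ∫ β in Metric.ball μ (4 / κ), Real.exp (κ * inner ℝ μ.1 β.1) ∂(uniformPrior d) := by
          refine setIntegral_mono_on (integrable_const _) hint.integrableOn
            measurableSet_ball fun β hβ => Real.exp_le_exp.2 ?_
          have h1 : ‖μ.1 - β.1‖ < 4 / κ := by
            rw [Metric.mem_ball, dist_comm, Subtype.dist_eq, dist_eq_norm] at hβ
            exact hβ
          have h2 := norm_sub_sq_sphere μ β
          have h3 : ‖μ.1 - β.1‖ ^ 2 ≤ (4 / κ) ^ 2 := by gcongr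
          rw [h2, div_pow, le_div_iff₀ (by positivity)] at h3
          nlinarith
      _ ≤ _ := setIntegral_le_integral hint (.of_forall fun β => (Real.exp_pos _).le)
  have hlog := Real.log_le_log (by positivity) hlow
  rw [Real.log_mul (by positivity) (by positivity), Real.log_exp, Real.log_pow, one_div,
    Real.log_inv] at hlog
  push_cast at hlog
  linarith

theorem toReal_klDiv_vonMisesFisher {d : ℕ} {κ : ℝ} (hκ : 0 < κ) (μ : Sph d) :
    (InformationTheory.klDiv (vonMisesFisher κ μ) (uniformPrior d)).toReal
      = κ * ∫ β, inner ℝ μ.1 β.1 ∂(vonMisesFisher κ μ)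
        - Real.log (∫ β, Real.exp (κ * inner ℝ μ.1 β.1) ∂(uniformPrior d)) := by
  have hp := isProbabilityMeasure_vonMisesFisher hκ μ
  rw [← integral_const_mul]
  rw [vonMisesFisher_eq_tilted hκ] at hp ⊢
  exact toReal_klDiv_tilted (integrable_exp_inner μ κ _) (integrable_mul_inner μ κ _)

/-- The mean of μ'β enters the divergence and the spread with opposite signs and cancels, so one
estimate of the normaliser controls both. -/
theorem toReal_klDiv_vonMisesFisher_add {d : ℕ} {κ : ℝ} (hκ : 8 ≤ κ) (μ : Sph d) :
    (InformationTheory.klDiv (vonMisesFisher κ μ) (uniformPrior d)).toReal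
      + κ / 2 * ∫ β, ‖μ.1 - β.1‖ ^ 2 ∂(vonMisesFisher κ μ) ≤ 1 + (d + 1) * Real.log κ := by
  have hκ0 : 0 < κ := by linarith
  have hp := isProbabilityMeasure_vonMisesFisher hκ0 μ
  have hi := integrable_mul_inner μ 1 (vonMisesFisher κ μ)
  simp only [one_mul] at hi
  rw [toReal_klDiv_vonMisesFisher hκ0]
  simp only [norm_sub_sq_sphere]
  rw [integral_const_mul, integral_sub (integrable_const _) hi]
  simp only [integral_const, probReal_univ, smul_eq_mul, one_mul]
  linarith [sub_log_integral_exp_inner_le μ hκ]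

theorem integral_le_toReal_klDiv_vonMisesFisher {d : ℕ} {Λ : Measure (Sph d)}
    (hΛ : Λ ∈ vmfFamily d) {φ : Sph d → ℝ} (hφ : Integrable φ Λ)
    (hexp : Integrable (fun x => Real.exp (φ x)) (uniformPrior d)) :
    ∫ x, φ x ∂Λ ≤ (InformationTheory.klDiv Λ (uniformPrior d)).toReal
      + Real.log (∫ x, Real.exp (φ x) ∂(uniformPrior d)) := by
  obtain ⟨κ, hκ, μ, rfl⟩ := hΛ
  have hp := isProbabilityMeasure_vonMisesFisher hκ μ
  refine integral_le_toReal_klDiv_add_log ?_ ?_ hφ hexp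
  · rw [vonMisesFisher_eq_tilted hκ]
    exact tilted_absolutelyContinuous _ _
  · rw [vonMisesFisher_eq_tilted hκ] at hp ⊢
    rw [integrable_congr (llr_tilted_self (integrable_exp_inner μ κ _))]
    exact (integrable_mul_inner μ κ _).sub (integrable_const _)

/-! ### Exponential moment of the squared deviation -/

theorem lintegral_exp_mul_gaussianReal (t : ℝ) :
    ∫⁻ g, ENNReal.ofReal (Real.exp (t * g)) ∂(gaussianReal 0 1)
      = ENNReal.ofReal (Real.exp (t ^ 2 / 2)) := by
  rw [← ofReal_integral_eq_lintegral_ofReal (integrable_exp_mul_gaussianReal t)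
    (.of_forall fun g => (Real.exp_pos _).le)]
  congr 1
  have := mgf_gaussianReal (p := gaussianReal 0 1) (X := id) (μ := 0) (v := 1) (by simp) t
  simpa [mgf] using this

theorem lintegral_exp_mul_sq_gaussianReal {t : ℝ} (ht : t < 1) :
    ∫⁻ g, ENNReal.ofReal (Real.exp (t * g ^ 2 / 2)) ∂(gaussianReal 0 1)
      = ENNReal.ofReal (√(1 - t))⁻¹ := by
  have hb : 0 < (1 - t) / 2 := by linarith
  rw [gaussianReal_of_var_ne_zero _ one_ne_zero,
    lintegral_withDensity_eq_lintegral_mul _ (measurable_gaussianPDF 0 1)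
      (by fun_prop : Measurable fun g : ℝ => ENNReal.ofReal (Real.exp (t * g ^ 2 / 2)))]
  have h1 : ∀ g : ℝ, (gaussianPDF 0 1 * fun g : ℝ => ENNReal.ofReal (Real.exp (t * g ^ 2 / 2))) g
      = ENNReal.ofReal ((√(2 * Real.pi))⁻¹ * Real.exp (-((1 - t) / 2) * g ^ 2)) := fun g => by
    rw [Pi.mul_apply, gaussianPDF, gaussianPDFReal, ← ENNReal.ofReal_mul (by positivity), mul_assoc,
      ← Real.exp_add]
    congr 3
    · simp
    · simp
      ring
  simp only [h1]
  rw [← ofReal_integral_eq_lintegral_ofReal ((integrable_exp_neg_mul_sq hb).const_mul _)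
    (.of_forall fun g => by positivity), integral_const_mul, integral_gaussian]
  congr 1
  rw [← Real.sqrt_inv, ← Real.sqrt_inv, ← Real.sqrt_mul (by positivity)]
  congr 1
  have : 1 - t ≠ 0 := by linarith
  field_simp

/-- The exponential of the square of a sub-Gaussian variable has a bounded expectation. -/
theorem HasSubgaussianMGF.lintegral_exp_mul_sq_le {Ω : Type*} [MeasurableSpace Ω] {μ : Measure Ω}
    [SFinite μ] {X : Ω → ℝ} {v : NNReal} (hX : HasSubgaussianMGF X v μ) (hm : Measurable X)
    {s : ℝ} (hs : 0 ≤ s) (hsv : s * v < 1) :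
    ∫⁻ ω, ENNReal.ofReal (Real.exp (s * X ω ^ 2 / 2)) ∂μ
      ≤ ENNReal.ofReal (√(1 - s * v))⁻¹ := by
  -- Gaussian linearisation: the exponential of a square is a Gaussian average of exponentials
  -- linear in X, to which the sub-Gaussian bound applies after Tonelli.
  have h1 : ∀ ω, ENNReal.ofReal (Real.exp (s * X ω ^ 2 / 2))
      = ∫⁻ g, ENNReal.ofReal (Real.exp (√s * X ω * g)) ∂(gaussianReal 0 1) := fun ω => by
    rw [lintegral_exp_mul_gaussianReal, mul_pow, Real.sq_sqrt hs]
  simp only [h1]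
  rw [lintegral_lintegral_swap (by fun_prop), ← lintegral_exp_mul_sq_gaussianReal hsv]
  refine lintegral_mono fun g => ?_
  have h2 : ∀ ω, √s * X ω * g = √s * g * X ω := fun ω => by ring
  simp only [h2]
  rw [← ofReal_integral_eq_lintegral_ofReal (hX.integrable_exp_mul _)
    (.of_forall fun g => (Real.exp_pos _).le)]
  refine ENNReal.ofReal_le_ofReal ((hX.mgf_le _).trans_eq ?_)
  rw [mul_pow, Real.sq_sqrt hs]
  congr 1
  ring

/-- The deviation of an empirical mean of `[0, 1]`-valued variables is sub-Gaussian. -/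
theorem hasSubgaussianMGF_integral_sub_mean {Z : Type*} [MeasurableSpace Z] (ν : Measure Z)
    [IsProbabilityMeasure ν] {f : Z → ℝ} (hf : Measurable f) (hb : ∀ᵐ z ∂ν, f z ∈ Icc 0 1)
    {n : ℕ} (hn : n ≠ 0) :
    HasSubgaussianMGF (fun S : Fin n → Z => ∫ z, f z ∂ν - (1 / n : ℝ) * ∑ i, f (S i))
      ((4 * n : NNReal)⁻¹) (Measure.pi fun _ => ν) := by
  -- Hoeffding's lemma gives proxy 1/4 per observation; summing n of them and scaling by 1/n leaves
  -- 1/(4n).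
  have h1 : HasSubgaussianMGF (fun z => f z - ∫ z, f z ∂ν) ((‖(1 : ℝ) - 0‖₊ / 2) ^ 2) ν :=
    hasSubgaussianMGF_of_mem_Icc hf.aemeasurable hb
  have h2 : ∀ i ∈ (Finset.univ : Finset (Fin n)), HasSubgaussianMGF
      (fun S : Fin n → Z => f (S i) - ∫ z, f z ∂ν) ((‖(1 : ℝ) - 0‖₊ / 2) ^ 2)
      (Measure.pi fun _ => ν) := fun i _ => by
    refine HasSubgaussianMGF.of_map (Y := fun S : Fin n → Z => S i)
      (X := fun z => f z - ∫ z, f z ∂ν) (measurable_pi_apply i).aemeasurable ?_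
    rw [(measurePreserving_eval (fun _ => ν) i).map_eq]
    exact h1
  have hind : iIndepFun (fun (i : Fin n) (S : Fin n → Z) => f (S i) - ∫ z, f z ∂ν)
      (Measure.pi fun _ => ν) :=
    iIndepFun_pi (X := fun _ z => f z - ∫ z, f z ∂ν) fun _ => (hf.sub_const _).aemeasurable
  have h3 := (HasSubgaussianMGF.sum_of_iIndepFun hind h2).const_mul (-(1 / n : ℝ))
  have hn' : (n : ℝ) ≠ 0 := by exact_mod_cast hn
  convert h3 using 1
  · ext S
    rw [Finset.sum_sub_distrib]
    simp only [Finset.sum_const, Finset.card_univ, Fintype.card_fin, nsmul_eq_mul]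
    field_simp
    ring
  · ext
    change (((4 * n : NNReal)⁻¹ : NNReal) : ℝ) = (-(1 / n : ℝ)) ^ 2
      * ((∑ i : Fin n, (‖(1 : ℝ) - 0‖₊ / 2) ^ 2 : NNReal) : ℝ)
    simp
    field_simp
    norm_num

theorem lintegral_exp_deviation_le {Z : Type*} [MeasurableSpace Z] (ν : Measure Z)
    [IsProbabilityMeasure ν] {f : Z → ℝ} (hf : Measurable f) (hb : ∀ᵐ z ∂ν, f z ∈ Icc 0 1)
    {n : ℕ} (hn : n ≠ 0) :
    ∫⁻ S : Fin n → Z, ENNReal.ofReal (Real.exp ((2 * n - 1 / 2)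
        * (∫ z, f z ∂ν - (1 / n : ℝ) * ∑ i, f (S i)) ^ 2)) ∂(Measure.pi fun _ => ν)
      ≤ ENNReal.ofReal (2 * √n) := by
  have hn1 : (1 : ℝ) ≤ n := by exact_mod_cast Nat.one_le_iff_ne_zero.2 hn
  have hm : Measurable fun S : Fin n → Z => ∫ z, f z ∂ν - (1 / n : ℝ) * ∑ i, f (S i) := by
    fun_prop
  -- With s = 4n − 1 the gap 1 − s/(4n) is 1/(4n), whose inverse square root is the 2√n of the
  -- criterion. Taking s = 4n would diverge, hence 2n − 1/2 in the exponent.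
  have he : 1 - (4 * (n : ℝ) - 1) * ((4 * n : NNReal)⁻¹ : NNReal) = (4 * (n : ℝ))⁻¹ := by
    push_cast
    field_simp
    ring
  have h := HasSubgaussianMGF.lintegral_exp_mul_sq_le
    (hasSubgaussianMGF_integral_sub_mean ν hf hb hn) hm (s := 4 * n - 1) (by linarith)
    (by have : (0 : ℝ) < (4 * (n : ℝ))⁻¹ := by positivity
        linarith)
  rw [he, Real.sqrt_inv, inv_inv, show (4 : ℝ) * n = 2 ^ 2 * n by norm_num,
    Real.sqrt_mul (by norm_num), Real.sqrt_sq two_pos.le] at h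
  refine le_trans (le_of_eq ?_) h
  congr with S
  congr 2
  ring

/-- The exponential moment event of the PAC-Bayes method has probability at least `1 - ε`. -/
theorem pi_lintegral_exp_deviation_le {Z Θ : Type*} [MeasurableSpace Z] [MeasurableSpace Θ]
    (ν : Measure Z) [IsProbabilityMeasure ν] (π : Measure Θ) [IsProbabilityMeasure π]
    {ℓ : Θ → Z → ℝ} (hℓ : Measurable fun p : Θ × Z => ℓ p.1 p.2)
    (hb : ∀ θ, ∀ᵐ z ∂ν, ℓ θ z ∈ Icc 0 1) {n : ℕ} (hn : n ≠ 0) {ε : ℝ} (hε : ε ∈ Ioo (0 : ℝ) 1) :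
    MeasurableSet {S : Fin n → Z | ∫⁻ θ, ENNReal.ofReal (Real.exp ((2 * n - 1 / 2)
        * (∫ z, ℓ θ z ∂ν - (1 / n : ℝ) * ∑ i, ℓ θ (S i)) ^ 2)) ∂π
          ≤ ENNReal.ofReal (2 * √n / ε)} ∧
    ENNReal.ofReal (1 - ε) ≤ (Measure.pi fun _ => ν)
      {S : Fin n → Z | ∫⁻ θ, ENNReal.ofReal (Real.exp ((2 * n - 1 / 2)
        * (∫ z, ℓ θ z ∂ν - (1 / n : ℝ) * ∑ i, ℓ θ (S i)) ^ 2)) ∂π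
          ≤ ENNReal.ofReal (2 * √n / ε)} := by
  have hn0 : 0 < 2 * √(n : ℝ) := by
    have : (0 : ℝ) < n := by exact_mod_cast Nat.pos_of_ne_zero hn
    positivity
  have hR : Measurable fun θ => ∫ z, ℓ θ z ∂ν :=
    (hℓ.stronglyMeasurable.integral_prod_right (ν := ν)).measurable
  have hsum : Measurable fun p : (Fin n → Z) × Θ => ∑ i, ℓ p.2 (p.1 i) :=
    Finset.measurable_sum _ fun i _ =>
      hℓ.comp (measurable_snd.prodMk ((measurable_pi_apply i).comp measurable_fst))
  have hjoint : Measurable fun p : (Fin n → Z) × Θ => ENNReal.ofReal (Real.exp ((2 * n - 1 / 2)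
        * (∫ z, ℓ p.2 z ∂ν - (1 / n : ℝ) * ∑ i, ℓ p.2 (p.1 i)) ^ 2)) := by
    have hR' : Measurable fun p : (Fin n → Z) × Θ => ∫ z, ℓ p.2 z ∂ν := hR.comp measurable_snd
    fun_prop
  have hmeas : Measurable fun S : Fin n → Z => ∫⁻ θ, ENNReal.ofReal (Real.exp ((2 * n - 1 / 2)
        * (∫ z, ℓ θ z ∂ν - (1 / n : ℝ) * ∑ i, ℓ θ (S i)) ^ 2)) ∂π :=
    hjoint.lintegral_prod_right
  refine ⟨measurableSet_le hmeas measurable_const, ?_⟩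
  have hA := measurableSet_le hmeas (measurable_const (a := ENNReal.ofReal (2 * √n / ε)))
  have htot : ∫⁻ S : Fin n → Z, ∫⁻ θ, ENNReal.ofReal (Real.exp ((2 * n - 1 / 2)
        * (∫ z, ℓ θ z ∂ν - (1 / n : ℝ) * ∑ i, ℓ θ (S i)) ^ 2)) ∂π ∂(Measure.pi fun _ => ν)
      ≤ ENNReal.ofReal (2 * √n) := by
    -- The prior does not depend on the sample, so the order of integration can be exchanged.
    rw [lintegral_lintegral_swap hjoint.aemeasurable]
    calc _ ≤ ∫⁻ _, ENNReal.ofReal (2 * √n) ∂π := lintegral_mono fun θ =>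
          lintegral_exp_deviation_le ν (hℓ.comp measurable_prodMk_left) (hb θ) hn
      _ = _ := by simp
  have hpos : 0 < 2 * √n / ε := div_pos hn0 hε.1
  have hmarkov := meas_ge_le_lintegral_div (μ := Measure.pi fun _ : Fin n => ν) hmeas.aemeasurable
    (ε := ENNReal.ofReal (2 * √n / ε)) (by simpa using hpos) ENNReal.ofReal_ne_top
  rw [← compl_compl {S : Fin n → Z | _}, prob_compl_eq_one_sub hA.compl,
    ENNReal.ofReal_sub _ hε.1.le, ENNReal.ofReal_one]
  refine tsub_le_tsub_left ((measure_mono fun S hS => ?_).trans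
    (hmarkov.trans ((ENNReal.div_le_div_right htot _).trans_eq ?_))) _
  · have h : ¬ (_ ≤ ENNReal.ofReal (2 * √n / ε)) := hS
    exact (not_le.1 h).le
  · rw [← ENNReal.ofReal_div_of_pos hpos]
    congr 1
    field_simp

theorem sq_integral_le_integral_sq {α : Type*} [MeasurableSpace α] {μ : Measure α}
    [IsProbabilityMeasure μ] {X : α → ℝ} (hX : MemLp X 2 μ) :
    (∫ x, X x ∂μ) ^ 2 ≤ ∫ x, X x ^ 2 ∂μ := by
  have h := variance_nonneg X μ
  rw [variance_eq_sub hX] at h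
  simpa using h

/-! ### Range of the loss, regularity of the risk, and the PAC-Bayes bound -/

theorem measurable_observe {d : ℕ} : Measurable (observe : Draw d → Obs d) := by
  have h1 : Measurable (Draw.y1 : Draw d → ℝ) := measurable_fst
  have h2 : Measurable (Draw.y0 : Draw d → ℝ) := measurable_fst.comp measurable_snd
  have h3 : Measurable (Draw.treat : Draw d → Bool) :=
    measurable_fst.comp (measurable_snd.comp measurable_snd)
  have h4 : MeasurableSet {w : Draw d | Draw.treat w = true} :=
    h3 (measurableSet_singleton true)
  exact (Measurable.ite h4 h1 h2).prodMk (h3.prodMk measurable_cov)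

instance isProbabilityMeasure_obsLaw {d : ℕ} (P : Measure (Draw d)) [IsProbabilityMeasure P] :
    IsProbabilityMeasure (obsLaw P) :=
  Measure.isProbabilityMeasure_map measurable_observe.aemeasurable

theorem measurable_score {d : ℕ} : Measurable fun p : Sph d × Cov d => score p.1 p.2 := by
  unfold score
  fun_prop

theorem measurable_loss {d : ℕ} {e : Cov d → ℝ} (he : Measurable e) (ψ B : ℝ) :
    Measurable fun p : Sph d × Obs d => loss e ψ B p.1 p.2 := by
  have htreat : Measurable fun p : Sph d × Obs d => p.2.2.1 := by fun_prop
  have hs : Measurable fun p : Sph d × Obs d => score p.1 p.2.2.2 :=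
    measurable_score.comp (by fun_prop : Measurable fun p : Sph d × Obs d => (p.1, p.2.2.2))
  have hrule : Measurable fun p : Sph d × Obs d => rule p.1 p.2.2.2 := by
    refine measurable_to_bool ?_
    have : (fun p : Sph d × Obs d => rule p.1 p.2.2.2) ⁻¹' {true}
        = {p | 0 ≤ score p.1 p.2.2.2} := by
      ext p
      simp [rule]
    rw [this]
    exact measurableSet_le measurable_const hs
  have hset : MeasurableSet {p : Sph d × Obs d | rule p.1 p.2.2.2 ≠ p.2.2.1} :=
    (measurableSet_eq_fun hrule htreat).compl
  have hE : Measurable fun p : Sph d × Obs d => e p.2.2.2 := he.comp (by fun_prop)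
  have hw : Measurable fun p : Sph d × Obs d => weight e ψ B p.2 := by
    unfold weight
    refine Measurable.div (by fun_prop) (Measurable.ite ?_ hE (hE.const_sub 1))
    exact htreat (measurableSet_singleton true)
  exact Measurable.ite hset hw measurable_const

/-- The observations with an outcome in `[0, B]` and a propensity score in `[ψ, 1 - ψ]`. -/
def regularObs {d : ℕ} (e : Cov d → ℝ) (ψ B : ℝ) : Set (Obs d) :=
  {z | z.1 ∈ Icc 0 B ∧ e z.2.2 ∈ Icc ψ (1 - ψ)}

theorem measurableSet_regularObs {d : ℕ} {e : Cov d → ℝ} (he : Measurable e) (ψ B : ℝ) :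
    MeasurableSet (regularObs e ψ B) :=
  (measurable_fst measurableSet_Icc).inter
    ((he.comp (measurable_snd.comp measurable_snd)) measurableSet_Icc)

theorem ae_mem_regularObs {d : ℕ} {P : Measure (Draw d)} {e : Cov d → ℝ} (he : Measurable e)
    {ψ B : ℝ} (hBO : BoundedOutcomes P B) {𝒳 : Set (Cov d)} (h𝒳 : ∀ᵐ w ∂P, Draw.cov w ∈ 𝒳)
    (hSO : StrictOverlap 𝒳 e ψ) : ∀ᵐ z ∂(obsLaw P), z ∈ regularObs e ψ B := by
  refine (ae_map_iff measurable_observe.aemeasurable (measurableSet_regularObs he ψ B)).2 ?_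
  filter_upwards [hBO, h𝒳] with w hw hx
  exact ⟨hw, hSO _ hx⟩

section loss

variable {d : ℕ} {e : Cov d → ℝ} {ψ B : ℝ}

theorem weight_mem_Icc (hψ : 0 < ψ) (hB : 0 < B) {z : Obs d} (hz : z ∈ regularObs e ψ B) :
    weight e ψ B z ∈ Icc 0 1 := by
  obtain ⟨⟨h0, h1⟩, h2, h3⟩ := hz
  have hden : ψ ≤ if z.2.1 then e z.2.2 else 1 - e z.2.2 := by
    split_ifs <;> linarith
  unfold weight
  refine ⟨div_nonneg (by positivity) (by linarith), (div_le_one (by linarith)).2 ?_⟩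
  calc z.1 * (ψ / B) ≤ B * (ψ / B) := by gcongr
    _ = ψ := by field_simp
    _ ≤ _ := hden

theorem loss_mem_Icc (hψ : 0 < ψ) (hB : 0 < B) (β : Sph d) {z : Obs d}
    (hz : z ∈ regularObs e ψ B) : loss e ψ B β z ∈ Icc 0 1 := by
  unfold loss
  split_ifs
  · exact weight_mem_Icc hψ hB hz
  · simp

/-- Scores of the same strict sign give the same decision, hence equal losses; otherwise both losses
still lie in [0, 1]. -/
theorem abs_loss_sub_le (hψ : 0 < ψ) (hB : 0 < B) (β₁ β₂ : Sph d) {z : Obs d}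
    (hz : z ∈ regularObs e ψ B) :
    |loss e ψ B β₁ z - loss e ψ B β₂ z|
      ≤ {z : Obs d | score β₁ z.2.2 * score β₂ z.2.2 ≤ 0}.indicator (fun _ => 1) z := by
  by_cases hs : score β₁ z.2.2 * score β₂ z.2.2 ≤ 0
  · rw [indicator_of_mem (by exact hs)]
    have h1 := loss_mem_Icc hψ hB β₁ hz
    have h2 := loss_mem_Icc hψ hB β₂ hz
    exact abs_sub_le_iff.2 ⟨by linarith [h1.2, h2.1], by linarith [h1.1, h2.2]⟩
  · rw [indicator_of_notMem (by exact hs)]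
    have hr : rule β₁ z.2.2 = rule β₂ z.2.2 := by
      unfold rule
      congr 1
      rw [not_le] at hs
      rcases pos_and_pos_or_neg_and_neg_of_mul_pos hs with ⟨h1, h2⟩ | ⟨h1, h2⟩
      · simp [h1.le, h2.le]
      · simp [not_le.2 h1, not_le.2 h2]
    unfold loss
    rw [hr]
    simp

variable {P : Measure (Draw d)} [IsProbabilityMeasure P]

theorem integrable_loss (he : Measurable e) (hψ : 0 < ψ) (hB : 0 < B)
    (hreg : ∀ᵐ z ∂(obsLaw P), z ∈ regularObs e ψ B) (β : Sph d) :
    Integrable (loss e ψ B β) (obsLaw P) :=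
  Integrable.of_mem_Icc 0 1 ((measurable_loss he ψ B).comp measurable_prodMk_left).aemeasurable
    (hreg.mono fun _ hz => loss_mem_Icc hψ hB β hz)

theorem risk_mem_Icc (he : Measurable e) (hψ : 0 < ψ) (hB : 0 < B)
    (hreg : ∀ᵐ z ∂(obsLaw P), z ∈ regularObs e ψ B) (β : Sph d) :
    risk P e ψ B β ∈ Icc 0 1 := by
  refine ⟨integral_nonneg_of_ae (hreg.mono fun _ hz => (loss_mem_Icc hψ hB β hz).1), ?_⟩
  have := integral_mono_ae (integrable_loss he hψ hB hreg β) (integrable_const 1)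
    (hreg.mono fun _ hz => (loss_mem_Icc hψ hB β hz).2)
  simpa [risk] using this

theorem abs_risk_sub_le (he : Measurable e) (hψ : 0 < ψ) (hB : 0 < B)
    (hreg : ∀ᵐ z ∂(obsLaw P), z ∈ regularObs e ψ B) {c : ℝ} (hCO : MarginCondition P c)
    (β₁ β₂ : Sph d) : |risk P e ψ B β₁ - risk P e ψ B β₂| ≤ c * ‖β₁.1 - β₂.1‖ := by
  have hi := fun β => integrable_loss he hψ hB hreg β
  have hs : ∀ β : Sph d, Measurable fun z : Obs d => score β z.2.2 := fun β =>
    measurable_score.comp (by fun_prop : Measurable fun z : Obs d => (β, z.2.2))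
  have hset : MeasurableSet {z : Obs d | score β₁ z.2.2 * score β₂ z.2.2 ≤ 0} :=
    measurableSet_le ((hs β₁).mul (hs β₂)) measurable_const
  unfold risk
  rw [← integral_sub (hi β₁) (hi β₂)]
  calc |∫ z, (loss e ψ B β₁ z - loss e ψ B β₂ z) ∂(obsLaw P)|
      ≤ ∫ z, |loss e ψ B β₁ z - loss e ψ B β₂ z| ∂(obsLaw P) := abs_integral_le_integral_abs
    _ ≤ ∫ z, {z : Obs d | score β₁ z.2.2 * score β₂ z.2.2 ≤ 0}.indicator (fun _ => (1 : ℝ)) z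
          ∂(obsLaw P) :=
        integral_mono_ae ((hi β₁).sub (hi β₂)).abs ((integrable_const 1).indicator hset)
          (hreg.mono fun _ hz => abs_loss_sub_le hψ hB β₁ β₂ hz)
    _ = P.real {w | score β₁ (Draw.cov w) * score β₂ (Draw.cov w) ≤ 0} := by
        rw [integral_indicator hset, setIntegral_const, smul_eq_mul, mul_one, obsLaw,
          map_measureReal_apply measurable_observe hset]
        rfl
    _ ≤ _ := hCO β₁ β₂

theorem continuous_risk (he : Measurable e) (hψ : 0 < ψ) (hB : 0 < B)
    (hreg : ∀ᵐ z ∂(obsLaw P), z ∈ regularObs e ψ B) {c : ℝ} (hCO : MarginCondition P c) :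
    Continuous (risk P e ψ B) := by
  refine (LipschitzWith.of_dist_le' (K := c) fun β₁ β₂ => ?_).continuous
  rw [Real.dist_eq, Subtype.dist_eq, dist_eq_norm]
  exact abs_risk_sub_le he hψ hB hreg hCO β₁ β₂

theorem empRisk_mem_Icc (hψ : 0 < ψ) (hB : 0 < B) {n : ℕ} {S : Fin n → Obs d}
    (hS : ∀ i, S i ∈ regularObs e ψ B) (β : Sph d) : empRisk e ψ B S β ∈ Icc 0 1 := by
  have h0 : 0 ≤ ∑ i, loss e ψ B β (S i) :=
    Finset.sum_nonneg fun i _ => (loss_mem_Icc hψ hB β (hS i)).1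
  have h1 : ∑ i, loss e ψ B β (S i) ≤ n := by
    simpa using Finset.sum_le_card_nsmul Finset.univ _ 1
      fun i _ => (loss_mem_Icc hψ hB β (hS i)).2
  unfold empRisk
  refine ⟨by positivity, ?_⟩
  rw [one_div, inv_mul_eq_div]
  exact div_le_one_of_le₀ h1 n.cast_nonneg

theorem measurable_empRisk (he : Measurable e) {n : ℕ} (S : Fin n → Obs d) :
    Measurable (empRisk e ψ B S) := by
  have h : ∀ i, Measurable fun β : Sph d => loss e ψ B β (S i) := fun i =>
    Measurable.of_uncurry_right (f := loss e ψ B) (measurable_loss he ψ B)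
  change Measurable fun β => (1 / n : ℝ) * ∑ i, loss e ψ B β (S i)
  generalize loss e ψ B = f at h
  fun_prop

/-- The two-sided PAC-Bayes inequality, on the exponential moment event. -/
theorem abs_expRisk_sub_empExpRisk_le (he : Measurable e) (hψ : 0 < ψ) (hB : 0 < B)
    (hreg : ∀ᵐ z ∂(obsLaw P), z ∈ regularObs e ψ B) {c : ℝ} (hCO : MarginCondition P c)
    {n : ℕ} (hn : n ≠ 0) {S : Fin n → Obs d} (hS : ∀ i, S i ∈ regularObs e ψ B) {M : ℝ}
    (hM : 0 ≤ M)
    (hexp : ∫⁻ β, ENNReal.ofReal (Real.exp ((2 * n - 1 / 2)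
      * (risk P e ψ B β - empRisk e ψ B S β) ^ 2)) ∂(uniformPrior d) ≤ ENNReal.ofReal M)
    {Λ : Measure (Sph d)} (hΛ : Λ ∈ vmfFamily d) :
    |expRisk P e ψ B Λ - empExpRisk e ψ B S Λ|
      ≤ √(((InformationTheory.klDiv Λ (uniformPrior d)).toReal + Real.log M)
        / (2 * n - 1 / 2)) := by
  have hn1 : (1 : ℝ) ≤ n := by exact_mod_cast Nat.one_le_iff_ne_zero.2 hn
  have ha : (0 : ℝ) < 2 * n - 1 / 2 := by linarith
  have hΛp : IsProbabilityMeasure Λ := by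
    obtain ⟨κ, hκ, μ, rfl⟩ := hΛ
    exact isProbabilityMeasure_vonMisesFisher hκ μ
  have hRm := (continuous_risk he hψ hB hreg hCO).measurable
  have hEm := measurable_empRisk (ψ := ψ) (B := B) he S
  have hR := risk_mem_Icc he hψ hB hreg
  have hE := empRisk_mem_Icc hψ hB hS
  set Δ : Sph d → ℝ := fun β => risk P e ψ B β - empRisk e ψ B S β with hΔ
  have hΔm : Measurable Δ := hRm.sub hEm
  have hΔb : ∀ β, |Δ β| ≤ 1 := fun β => abs_sub_le_iff.2
    ⟨by linarith [(hR β).2, (hE β).1], by linarith [(hR β).1, (hE β).2]⟩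
  have hφb : ∀ β, (2 * n - 1 / 2) * Δ β ^ 2 ∈ Icc 0 (2 * (n : ℝ) - 1 / 2) := fun β =>
    ⟨by positivity, mul_le_of_le_one_right ha.le ((sq_le_one_iff_abs_le_one _).2 (hΔb β))⟩
  have hφm : Measurable fun β => (2 * n - 1 / 2) * Δ β ^ 2 := by fun_prop
  have hφ : Integrable (fun β => (2 * n - 1 / 2) * Δ β ^ 2) Λ :=
    Integrable.of_mem_Icc 0 _ hφm.aemeasurable (.of_forall hφb)
  have heint : Integrable (fun β => Real.exp ((2 * n - 1 / 2) * Δ β ^ 2)) (uniformPrior d) :=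
    Integrable.of_mem_Icc 0 (Real.exp (2 * n - 1 / 2)) (by fun_prop)
      (.of_forall fun β => ⟨(Real.exp_pos _).le, Real.exp_le_exp.2 (hφb β).2⟩)
  have hDV := integral_le_toReal_klDiv_vonMisesFisher hΛ hφ heint
  rw [← ofReal_integral_eq_lintegral_ofReal heint (.of_forall fun β => (Real.exp_pos _).le),
    ENNReal.ofReal_le_ofReal_iff hM] at hexp
  have hlog := Real.log_le_log (integral_exp_pos heint) hexp
  rw [integral_const_mul] at hDV
  -- Jensen passes from the mean of Δ², which Donsker–Varadhan controls, to the square of the mean.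
  have hJ : (∫ β, Δ β ∂Λ) ^ 2 ≤ ∫ β, Δ β ^ 2 ∂Λ :=
    sq_integral_le_integral_sq
      (MemLp.of_bound hΔm.aestronglyMeasurable 1 (.of_forall fun β => hΔb β))
  have hdiff : expRisk P e ψ B Λ - empExpRisk e ψ B S Λ = ∫ β, Δ β ∂Λ := by
    unfold expRisk empExpRisk
    rw [← integral_sub (Integrable.of_mem_Icc 0 1 hRm.aemeasurable (.of_forall hR))
      (Integrable.of_mem_Icc 0 1 hEm.aemeasurable (.of_forall hE))]
  rw [hdiff]
  refine Real.abs_le_sqrt ((le_div_iff₀ ha).2 ?_)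
  nlinarith

end loss

/-! ### Numerical estimates -/

/-- This is the price of 2n − 1/2 against the 2n of the criterion: (1 + 2/(7x))(1 − 1/(4x)) ≥ 1
exactly when x ≥ 2. -/
theorem sqrt_div_le_mul_sqrt {A x : ℝ} (hA : 0 ≤ A) (hx : 2 ≤ x) :
    √(A / (2 * x - 1 / 2)) ≤ (1 + 1 / (7 * x)) * √(1 / (2 * x) * A) := by
  have h1 : (1 + 1 / (7 * x)) = √((1 + 1 / (7 * x)) ^ 2) :=
    (Real.sqrt_sq (by positivity)).symm
  rw [h1, ← Real.sqrt_mul (by positivity)]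
  refine Real.sqrt_le_sqrt ?_
  rw [div_eq_mul_inv, mul_comm A, ← mul_assoc]
  refine mul_le_mul_of_nonneg_right ?_ hA
  have h2 : 1 + 2 * (1 / (7 * x)) ≤ (1 + 1 / (7 * x)) ^ 2 := by
    nlinarith [sq_nonneg (1 / (7 * x))]
  refine le_trans ?_ (mul_le_mul_of_nonneg_right h2 (by positivity))
  rw [inv_eq_one_div, div_le_iff₀ (by linarith)]
  have h3 : (1 + 2 * (1 / (7 * x))) * (1 / (2 * x)) * (2 * x - 1 / 2)
      = 1 + (x - 2) / (28 * x ^ 2) := by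
    field_simp
    ring
  rw [h3]
  have : 0 ≤ (x - 2) / (28 * x ^ 2) := div_nonneg (by linarith) (by positivity)
  linarith

theorem two_le_log_of_eight_le {x : ℝ} (hx : 8 ≤ x) : 2 ≤ Real.log x := by
  have h : Real.log 8 = 3 * Real.log 2 := by
    rw [show (8 : ℝ) = 2 ^ 3 by norm_num, Real.log_pow]
    norm_num
  have := Real.log_le_log (by norm_num) hx
  linarith [Real.log_two_gt_d9]

/-- The square-root terms of M are dropped and ln 9 / ln 8 is replaced by 1; the rest of M suffices.
-/
theorem le_regretConst {d : ℕ} {c ε : ℝ} (hε : ε ∈ Ioo (0 : ℝ) 1) :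
    4 * c * √(((d : ℝ) + 1) / 2) + (2 + d / 2 + Real.log (2 / ε)) ≤ regretConst d c ε := by
  have h8 : 0 < Real.log 8 := Real.log_pos (by norm_num)
  have hr : 1 ≤ Real.log 9 / Real.log 8 :=
    (one_le_div h8).2 (Real.log_le_log (by norm_num) (by norm_num))
  have hl : Real.log (2 * Real.exp 1 / ε) = Real.log (2 / ε) + 1 := by
    rw [mul_div_right_comm, Real.log_mul (div_pos two_pos hε.1).ne' (Real.exp_pos 1).ne',
      Real.log_exp]
  have hd : (d : ℝ) / 2 * 1 ≤ d / 2 * (Real.log 9 / Real.log 8) := by gcongr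
  unfold regretConst
  simp only
  rw [hl, show ((d : ℝ) + 1) / 2 - 1 + 1 = (d + 1) / 2 by ring,
    show ((d : ℝ) + 1) / 2 - 1 + 1 / 2 = d / 2 by ring]
  have p1 := Real.sqrt_nonneg ((d : ℝ) / 2 * Real.log 9 / (2 * Real.log 8))
  have p2 := Real.sqrt_nonneg (1 / 2 * Real.log (4 * Real.exp 1 / ε))
  have p3 : 0 ≤ √(Real.log 8) / (√2 * Real.log 8) := by positivity
  linarith

theorem regret_arithmetic {d : ℕ} {c ε x K V : ℝ} (hx : 8 ≤ x) (hc : 0 < c)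
    (hε : ε ∈ Ioo (0 : ℝ) 1) (hK : 0 ≤ K) (hKle : K ≤ 1 + (d + 1) * Real.log x)
    (hV : x / 2 * V ^ 2 ≤ 1 + (d + 1) * Real.log x) (hV0 : 0 ≤ V) :
    c * V + (2 + 2 * (1 / (7 * x))) * √(1 / (2 * x) * (K + Real.log (2 * √x / ε)))
      + 2 * (1 / (7 * x)) ≤ regretConst d c ε * (Real.log x / √x) := by
  have hx0 : 0 < x := by linarith
  have hL := two_le_log_of_eight_le hx
  set L := Real.log x with hLdef
  set s := √x with hs
  have hs0 : 0 < s := Real.sqrt_pos.2 hx0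
  have hss : s ^ 2 = x := Real.sq_sqrt hx0.le
  have hs2 : 2 ≤ s := by nlinarith
  set ℓ := Real.log (2 / ε) with hℓdef
  have hℓ : 0 ≤ ℓ := Real.log_nonneg ((one_le_div hε.1).2 (by linarith [hε.2]))
  have hlog : Real.log (2 * s / ε) = ℓ + L / 2 := by
    rw [mul_div_right_comm, Real.log_mul (div_pos two_pos hε.1).ne' hs0.ne', hs,
      Real.log_sqrt hx0.le]
  rw [hlog]
  have hd0 : (0 : ℝ) ≤ d := d.cast_nonneg
  set A := K + (ℓ + L / 2) with hA
  have hA0 : 0 ≤ A := by positivity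
  have hT : √(1 / (2 * x) * A) = √(A / 2) / s := by
    rw [show 1 / (2 * x) * A = A / 2 / x by field_simp, Real.sqrt_div (by positivity)]
  -- From (√(A/2) − 2)² ≥ 0. Linearising is affordable because A is of order ln x and the target
  -- allows a full factor ln x.
  have hq : √(A / 2) ≤ A / 8 + 1 := by
    have h1 := Real.sq_sqrt (by positivity : 0 ≤ A / 2)
    nlinarith [sq_nonneg (√(A / 2) - 2)]
  have hη : 1 / (7 * x) ≤ 1 / 56 := one_div_le_one_div_of_le (by norm_num) (by linarith)
  have hη' : 2 * (1 / (7 * x)) ≤ (1 / 7) / s := by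
    rw [← hss, show 2 * (1 / (7 * s ^ 2)) = (2 / (7 * s)) / s by field_simp]
    refine div_le_div_of_nonneg_right ?_ hs0.le
    rw [div_le_div_iff₀ (by positivity) (by norm_num)]
    linarith
  have hVs : V ≤ 4 * √(((d : ℝ) + 1) / 2) * L / s := by
    rw [le_div_iff₀ hs0]
    refine (pow_le_pow_iff_left₀ (by positivity) (by positivity) two_ne_zero).1 ?_
    rw [mul_pow, mul_pow, mul_pow, Real.sq_sqrt (by positivity : 0 ≤ ((d : ℝ) + 1) / 2), hss]
    have h1 : L * 2 ≤ L * L := by gcongr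
    have h2 : d * (L * 2) ≤ d * (L * L) := by gcongr
    have h3 : 0 ≤ d * L := by positivity
    linarith
  have hM := le_regretConst (d := d) (c := c) hε
  have hLs : 0 ≤ L / s := by positivity
  refine le_trans ?_ (mul_le_mul_of_nonneg_right hM hLs)
  rw [hT]
  have h1 : c * V ≤ c * (4 * √(((d : ℝ) + 1) / 2) * L / s) := by gcongr
  -- 2.04 rounds up 2 + 2/56, the value of the factor at x = 8.
  have h2 : (2 + 2 * (1 / (7 * x))) * (√(A / 2) / s) ≤ (2.04 * (A / 8 + 1)) / s := by
    rw [← mul_div_assoc]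
    gcongr
    linarith
  have h3 : (2.04 * (A / 8 + 1)) / s + (1 / 7) / s ≤ (2 + d / 2 + ℓ) * (L / s) := by
    rw [← add_div, ← mul_div_assoc]
    gcongr
    have h4 : ℓ * 2 ≤ ℓ * L := by gcongr
    have h5 : 0 ≤ (d : ℝ) * L := by positivity
    norm_num
    nlinarith
  calc _ ≤ c * (4 * √(((d : ℝ) + 1) / 2) * L / s) + (2 + d / 2 + ℓ) * (L / s) := by linarith
    _ = _ := by ring

/-! ### The regret bound -/

theorem mainTheorem4 {d n : ℕ} (hn : 8 ≤ n)
    (P : Measure (Draw d)) [IsProbabilityMeasure P]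
    (Q : Measure (ℝ × ℝ × Cov d)) (hEV : ExternalValidity P Q)
    (hU : Unconfounded P)
    (B : ℝ) (hB : 0 < B) (hBO : BoundedOutcomes P B)
    (𝒳 : Set (Cov d)) (h𝒳 : ∀ᵐ w ∂P, Draw.cov w ∈ 𝒳)
    (e : Cov d → ℝ) (he : IsPropensityScore P e)
    (ψ : ℝ) (hψ : ψ ∈ Ioo (0 : ℝ) (1 / 2)) (hSO : StrictOverlap 𝒳 e ψ)
    (c : ℝ) (hc : 0 < c) (hCO : MarginCondition P c)
    (ε : ℝ) (hε : ε ∈ Ioo (0 : ℝ) 1) :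
    ∃ A : Set (Fin n → Obs d), MeasurableSet A ∧
      ENNReal.ofReal (1 - ε) ≤ sampleLaw P n A ∧
      ∀ S ∈ A, ∀ δ : ℝ, 0 ≤ δ → ∀ Λ : Measure (Sph d),
        IsVariationalPosterior e ψ B ε S δ Λ →
          expRisk P e ψ B Λ - optRisk P e ψ B
            ≤ regretConst d c ε * (Real.log n / √n) + δ := by
  have hem := he.1
  have hψ0 := hψ.1
  have hreg := ae_mem_regularObs (P := P) hem hBO h𝒳 hSO
  have hn0 : n ≠ 0 := by omega
  have hn8 : (8 : ℝ) ≤ n := by exact_mod_cast hn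
  have hnpos : (0 : ℝ) < n := by linarith
  obtain ⟨hA, hAp⟩ := pi_lintegral_exp_deviation_le (obsLaw P) (uniformPrior d)
    (measurable_loss hem ψ B) (fun β => hreg.mono fun _ hz => loss_mem_Icc hψ0 hB β hz) hn0 hε
  have hregS : ∀ᵐ S ∂(sampleLaw P n), ∀ i, S i ∈ regularObs e ψ B :=
    ae_all_iff.2 fun i => (measurePreserving_eval (fun _ => obsLaw P) i).quasiMeasurePreserving.ae
      hreg
  have hGm : MeasurableSet {S : Fin n → Obs d | ∀ i, S i ∈ regularObs e ψ B} := by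
    have := MeasurableSet.iInter fun i : Fin n =>
      (measurable_pi_apply (X := fun _ : Fin n => Obs d) i) (measurableSet_regularObs hem ψ B)
    convert this using 1
    ext S
    simp
  -- Almost every sample is regular, so the intersection costs no probability. The event involves
  -- neither δ nor Λ, which makes the bound simultaneous.
  refine ⟨_, hA.inter hGm, ?_, ?_⟩
  · refine hAp.trans (le_of_eq ?_)
    refine measure_congr ?_
    filter_upwards [hregS] with S hS
    exact propext ⟨fun h => ⟨h, hS⟩, fun h => h.1⟩
  rintro S ⟨hSA, hS⟩ δ hδ Λ ⟨hΛ, hmin⟩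
  have hM1 : 1 ≤ 2 * √(n : ℝ) / ε := by
    have : 1 ≤ √(n : ℝ) := Real.one_le_sqrt.2 (by linarith)
    rw [one_le_div hε.1]
    linarith [hε.2]
  have hlogM := Real.log_nonneg hM1
  have hPB := fun Λ' (h : Λ' ∈ vmfFamily d) =>
    abs_expRisk_sub_empExpRisk_le hem hψ0 hB hreg hCO hn0 hS (by linarith) hSA (Λ := Λ') h
  have hRc := continuous_risk hem hψ0 hB hreg hCO
  have hR := risk_mem_Icc hem hψ0 hB hreg
  have hE := empRisk_mem_Icc hψ0 hB hS
  have hRint : ∀ Λ' : Measure (Sph d), IsProbabilityMeasure Λ' →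
      Integrable (risk P e ψ B) Λ' := fun Λ' _ =>
    Integrable.of_mem_Icc 0 1 hRc.measurable.aemeasurable (.of_forall hR)
  have : Nonempty (Sph d) := ⟨⟨EuclideanSpace.single 0 1, by simp⟩⟩
  obtain ⟨β, -, hβ⟩ := isCompact_univ.exists_isMinOn (univ_nonempty (α := Sph d)) hRc.continuousOn
  have hβ' : ∀ β', risk P e ψ B β ≤ risk P e ψ B β' := fun β' => hβ (mem_univ β')
  have hopt : risk P e ψ B β ≤ optRisk P e ψ B := by
    have : Nonempty (ProbabilityMeasure (Sph d)) := ⟨⟨uniformPrior d, inferInstance⟩⟩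
    refine le_ciInf fun Λ' => ?_
    have := integral_mono (μ := (Λ' : Measure (Sph d))) (integrable_const _)
      (hRint Λ' inferInstance) hβ'
    simpa [expRisk] using this
  -- κ = n balances the two costs: divergence of order ln n and mean distance to β of order √(ln n /
  -- n).
  set Λ₀ := vonMisesFisher (n : ℝ) β with hΛ₀
  have hΛ₀m : Λ₀ ∈ vmfFamily d := ⟨n, hnpos, β, rfl⟩
  have hΛ₀p : IsProbabilityMeasure Λ₀ := isProbabilityMeasure_vonMisesFisher hnpos β
  have hΛp : IsProbabilityMeasure Λ := by
    obtain ⟨κ, hκ, μ, rfl⟩ := hΛ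
    exact isProbabilityMeasure_vonMisesFisher hκ μ
  have hKL := toReal_klDiv_vonMisesFisher_add hn8 β
  rw [← hΛ₀] at hKL
  have hnormc : Continuous fun β' : Sph d => ‖β.1 - β'.1‖ := by fun_prop
  have hnormi : Integrable (fun β' : Sph d => ‖β.1 - β'.1‖) Λ₀ :=
    hnormc.integrable_of_hasCompactSupport (HasCompactSupport.of_compactSpace _)
  have hnorm2 : MemLp (fun β' : Sph d => ‖β.1 - β'.1‖) 2 Λ₀ :=
    hnormc.memLp_of_hasCompactSupport (HasCompactSupport.of_compactSpace _)
  have hJ := sq_integral_le_integral_sq hnorm2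
  set V := ∫ β', ‖β.1 - β'.1‖ ∂Λ₀ with hV
  have hV0 : 0 ≤ V := integral_nonneg fun _ => norm_nonneg _
  set K := (InformationTheory.klDiv Λ₀ (uniformPrior d)).toReal with hK
  have hK0 : 0 ≤ K := ENNReal.toReal_nonneg
  have hV2 : n / 2 * V ^ 2 ≤ n / 2 * ∫ β', ‖β.1 - β'.1‖ ^ 2 ∂Λ₀ := by gcongr
  have hV20 : 0 ≤ n / 2 * V ^ 2 := by positivity
  have harith := regret_arithmetic (d := d) (c := c) (ε := ε) hn8 hc hε hK0 (by linarith)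
    (by linarith) hV0
  have hcomp : expRisk P e ψ B Λ₀ ≤ risk P e ψ B β + c * V := by
    have := integral_mono (hRint Λ₀ hΛ₀p)
      ((integrable_const (risk P e ψ B β)).add (hnormi.const_mul c)) fun β' => by
        have h := (abs_le.1 (abs_risk_sub_le hem hψ0 hB hreg hCO β β')).1
        change risk P e ψ B β' ≤ risk P e ψ B β + c * ‖β.1 - β'.1‖
        linarith
    refine this.trans_eq ?_
    simp only [Pi.add_apply]
    rw [integral_add (integrable_const _) (hnormi.const_mul c), integral_const_mul, integral_const]
    rw [probReal_univ, one_smul]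
  have hunit : ∀ (f : Sph d → ℝ) (Λ' : Measure (Sph d)), IsProbabilityMeasure Λ' → Measurable f →
      (∀ β', f β' ∈ Icc (0 : ℝ) 1) → ∫ β', f β' ∂Λ' ∈ Icc (0 : ℝ) 1 := fun f Λ' _ hf hb => by
    refine ⟨integral_nonneg fun β' => (hb β').1, ?_⟩
    have := integral_mono (Integrable.of_mem_Icc 0 1 hf.aemeasurable (.of_forall hb))
      (integrable_const (μ := Λ') (1 : ℝ)) fun β' => (hb β').2
    simpa using this
  have hRΛ : expRisk P e ψ B Λ ∈ Icc (0 : ℝ) 1 := hunit _ Λ hΛp hRc.measurable hR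
  have hEΛ : empExpRisk e ψ B S Λ ∈ Icc (0 : ℝ) 1 :=
    hunit _ Λ hΛp (measurable_empRisk hem S) hE
  have hEΛ₀ : empExpRisk e ψ B S Λ₀ ∈ Icc (0 : ℝ) 1 :=
    hunit _ Λ₀ hΛ₀p (measurable_empRisk hem S) hE
  set T := √(1 / (2 * n) * ((InformationTheory.klDiv Λ (uniformPrior d)).toReal
    + Real.log (2 * √n / ε))) with hT
  set T₀ := √(1 / (2 * n) * (K + Real.log (2 * √n / ε))) with hT₀
  have hT₀0 : 0 ≤ T₀ := Real.sqrt_nonneg _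
  have hη : (0 : ℝ) ≤ 1 / (7 * n) := by positivity
  have hcrit : empExpRisk e ψ B S Λ + T ≤ empExpRisk e ψ B S Λ₀ + T₀ + δ := hmin Λ₀ hΛ₀m
  have h1 := (abs_le.1 (hPB Λ hΛ)).2
  have h2 := (abs_le.1 (hPB Λ₀ hΛ₀m)).1
  have h3 := sqrt_div_le_mul_sqrt (x := n)
    (add_nonneg (ENNReal.toReal_nonneg
      (a := InformationTheory.klDiv Λ (uniformPrior d))) hlogM) (by linarith)
  have h4 := sqrt_div_le_mul_sqrt (x := n) (add_nonneg hK0 hlogM) (by linarith)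
  rw [← hT] at h3
  rw [← hT₀] at h4
  have hβ0 := (hR β).1
  -- The excess T/(7n) needs an a priori bound on T. Near-minimality gives T ≤ 2 + T₀ when δ < 1;
  -- for δ ≥ 1 the claim is trivial because risks lie in [0, 1].
  rcases le_or_gt 1 δ with hδ1 | hδ1
  · have : 0 ≤ c * V := by positivity
    have : 0 ≤ (2 + 2 * (1 / (7 * (n : ℝ)))) * T₀ := by positivity
    linarith [hRΛ.2]
  · have hTle : T ≤ 2 + T₀ := by linarith [hEΛ.1, hEΛ₀.2]
    have : 1 / (7 * (n : ℝ)) * T ≤ 1 / (7 * n) * (2 + T₀) := by gcongr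
    linarith
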